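/- **Model.** Let $A$ be a real $L\times J$ matrix, $F$ a real $J\times p$ matrix, $\beta\in\mathbb R^p$, $\sigma>0$, $\gamma>0$. Let $Z=\{Z(t)\}_{t\in\mathbb Z}$ be a (strictly) stationary Gaussian process with values in $\mathbb R^J$ such that $Z(t)\sim\mathcal N(0,I_J)$ for every $t$ and ${\rm Corr}(Z_j(t),Z_j(t+i))=\rho(i)$ for all $t\in\mathbb Z$, $i\ge 0$ and $1\le j\le J$, with the same function $\rho$ for all $j$. Put $$Y(t)=AF\beta+\sigma A\,{\rm diag}(|F\beta|^{\gamma})\,Z(t),$$ where powers and absolute values of vectors are taken coordinatewise. Let $\mathcal O\subset\{1,\dots,L\}$, let $A_o$ be the matrix of the rows of $A$ with index in $\mathcal O$, let $Y_o(t)=(Y_\ell(t))_{\ell\in\mathcal O}$, fix $t_0\in\mathbb Z$, and for $m\ge1$ set $$\overline Y_o=\frac1m\sum_{k=0}^{m-1}Y_o(t_0-k),\qquad \sigma_m^2=\frac{\sigma^2}{m}\Big(1+2\sum_{i=1}^{m-1}(1-i/m)\rho(i)\Big).$$ For $b\in\mathbb R^p$ let $$G(b)=[A_o\,{\rm diag}(|Fb|^{2\gamma})A_o^t]^{-1},\qquad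 \Sigma_{GLS}(b)=[(A_oF)^tG(b)A_oF]^{-1}.$$ The iterated GLS estimates are $\widehat\beta_1=[(A_oF)^tA_oF]^{-1}(A_oF)^t\,\overline Y_o$ and $$\widehat\beta_{k+1}=\Sigma_{GLS}(\widehat\beta_k)(A_oF)^tG(\widehat\beta_k)\,\overline Y_o,\qquad k\ge1;$$ $\widehat\beta_k$ is well defined if all matrices inverted in the construction of $\widehat\beta_1,\dots,\widehat\beta_k$ are invertible. The GLS estimate is $\widehat\beta_{GLS}=\Sigma_{GLS}(\beta)(A_oF)^tG(\beta)\,\overline Y_o$. All these estimates depend on $m$. **Theorem.** Suppose that $A_o$ has full row rank, that $A_oF$ has full column rank, and that all coordinates of $F\beta$ are positive. If $\rho(\tau)\to0$ as $\tau\to\infty$, then: (i) for every $k\ge1$, almost surely, for all sufficiently large $m$, all coordinates of $F\widehat\beta_k$ are positive and $\widehat\beta_k$ is well defined; (ii) for every $k\ge1$, $\widehat\beta_k\to\beta$ almost surely as $m\to\infty$; (iii) for every $k\ge2$, $\widehat\beta_k-\widehat\beta_{GLS}=o_P(\sigma_m)$ as $m\to\infty$, that is, $P(\|\widehat\beta_k-\widehat\beta_{GLS}\|>\varepsilon\sigma_m)\to0$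 for every $\varepsilon>0$. Moreover, whether or not $\rho(\tau)\to 0$, the inverses $G(\beta)$ and $\Sigma_{GLS}(\beta)$ exist, and, if in addition ${\rm Cov}(Z_i(s),Z_j(t))=0$ for all $i\ne j$ and all $s,t\in\mathbb Z$, then for every $m\ge1$ the estimate $\widehat\beta_{GLS}$ has finite second moments and ${\rm Var}(\widehat\beta_{GLS})=\sigma_m^2\,\Sigma_{GLS}(\beta)$. -/

import Mathlib

open MeasureTheory ProbabilityTheory Filter Topology Matrix

noncomputable section

namespace NetworkTraffic

variable {Ω J L : Type*} {p : ℕ}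

/-- `Z(t)`, `t ∈ ℤ`, is a (strictly) stationary Gaussian process with values in `ℝ^J`, with
`Z(t) ∼ N(0, I_J)` for every `t`, and with one and the same temporal correlation function `ρ`
in all coordinates: `Corr (Z_j(t), Z_j(t+i)) = ρ(i)`. As the coordinates have variance one,
correlations are covariances. No assumption is made on the covariance of `Z_i(s)` and `Z_j(t)`
for `i ≠ j` and `s ≠ t`, besides stationarity. -/
structure IsStationaryGaussianNoise [MeasurableSpace Ω] [Fintype J]
    (P : Measure Ω) (Z : ℤ → Ω → (J → ℝ)) (ρ : ℕ → ℝ) : Prop where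
  gaussian : IsGaussianProcess Z P
  stationary : ∀ h : ℤ,
    IdentDistrib (fun ω (t : ℤ) => Z (t + h) ω) (fun ω (t : ℤ) => Z t ω) P P
  marginal : ∀ t : ℤ, HasLaw (Z t) (Measure.pi fun _ : J => gaussianReal 0 1) P
  temporal : ∀ (j : J) (t : ℤ) (i : ℕ),
    cov[fun ω => Z t ω j, fun ω => Z (t + i) ω j; P] = ρ i

/-- Coordinates with different indices are uncorrelated at all pairs of times. -/
def CrossUncorrelated [MeasurableSpace Ω] (P : Measure Ω) (Z : ℤ → Ω → (J → ℝ)) : Prop :=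
  ∀ i j : J, i ≠ j → ∀ s t : ℤ, cov[fun ω => Z s ω i, fun ω => Z t ω j; P] = 0

/-- The rows `A_o` of the routing matrix `A` that belong to the observed links `O`. -/
def obsRows (A : Matrix L J ℝ) (O : Finset L) : Matrix O J ℝ :=
  A.submatrix (fun l : O => (l : L)) id

/-- The traffic on all links, `Y(t) = A F β + σ A diag(|F β|^γ) Z(t)`. -/
def linkTraffic [Fintype J] [DecidableEq J] (A : Matrix L J ℝ) (F : Matrix J (Fin p) ℝ)
    (β : Fin p → ℝ) (σ γ : ℝ) (Z : ℤ → Ω → (J → ℝ)) (t : ℤ) (ω : Ω) : L → ℝ :=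
  (A * F) *ᵥ β + σ • ((A * diagonal fun j => |(F *ᵥ β) j| ^ γ) *ᵥ Z t ω)

/-- The time average `m⁻¹ ∑_{k=0}^{m-1} Y_o(t₀ - k)` of the traffic on the observed links. -/
def obsMean (O : Finset L) (Y : ℤ → Ω → (L → ℝ)) (t₀ : ℤ) (m : ℕ) (ω : Ω) : O → ℝ :=
  fun l => (1 / (m : ℝ)) * ∑ k ∈ Finset.range m, Y (t₀ - (k : ℤ)) ω l

/-- `σ_m² = (σ² / m) (1 + 2 ∑_{i=1}^{m-1} (1 - i/m) ρ(i))`. -/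
def sigmaSq (σ : ℝ) (ρ : ℕ → ℝ) (m : ℕ) : ℝ :=
  σ ^ 2 / m * (1 + 2 * ∑ i ∈ Finset.Ico 1 m, (1 - (i : ℝ) / m) * ρ i)

section Estimators

/- Here `Ao` stands for the matrix `A_o`, with rows indexed by the observed links, and `y` for the
averaged observation. -/
variable {O : Type*} [Fintype O] [DecidableEq O] [Fintype J] [DecidableEq J]
  (Ao : Matrix O J ℝ) (F : Matrix J (Fin p) ℝ) (γ : ℝ)

/-- `A_o diag(|F b|^{2γ}) A_oᵗ`. -/
def linkCov (b : Fin p → ℝ) : Matrix O O ℝ :=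
  Ao * (diagonal fun j => |(F *ᵥ b) j| ^ (2 * γ)) * Aoᵀ

/-- `G(b) = [A_o diag(|F b|^{2γ}) A_oᵗ]⁻¹`. -/
def G (b : Fin p → ℝ) : Matrix O O ℝ := (linkCov Ao F γ b)⁻¹

/-- `(A_o F)ᵗ G(b) A_o F`. -/
def glsGram (b : Fin p → ℝ) : Matrix (Fin p) (Fin p) ℝ :=
  (Ao * F)ᵀ * G Ao F γ b * (Ao * F)

/-- `Σ_GLS(b) = [(A_o F)ᵗ G(b) A_o F]⁻¹`. -/
def SigmaGLS (b : Fin p → ℝ) : Matrix (Fin p) (Fin p) ℝ := (glsGram Ao F γ b)⁻¹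

/-- The generalized least squares estimate with weight matrix `G(b)`:
`[(A_o F)ᵗ G(b) A_o F]⁻¹ (A_o F)ᵗ G(b) y`. -/
def glsEstimate (b : Fin p → ℝ) (y : O → ℝ) : Fin p → ℝ :=
  (SigmaGLS Ao F γ b * (Ao * F)ᵀ * G Ao F γ b) *ᵥ y

/-- Both inverses in `glsEstimate Ao F γ b` exist. -/
def GLSWellDefined (b : Fin p → ℝ) : Prop :=
  IsUnit (linkCov Ao F γ b) ∧ IsUnit (glsGram Ao F γ b)

/-- The ordinary least squares estimate `[(A_o F)ᵗ A_o F]⁻¹ (A_o F)ᵗ y`. -/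
def olsEstimate (y : O → ℝ) : Fin p → ℝ :=
  (((Ao * F)ᵀ * (Ao * F))⁻¹ * (Ao * F)ᵀ) *ᵥ y

/-- The iterated GLS estimates `β̂_k`, `k ≥ 1`: `β̂_1` is the OLS estimate, and `β̂_{k+1}` is the
GLS estimate with weight `G(β̂_k)`. The value at index `0` is a placeholder that is not used. -/
def iGLS (y : O → ℝ) : ℕ → (Fin p → ℝ)
  | 0 => 0
  | 1 => olsEstimate Ao F y
  | k + 2 => glsEstimate Ao F γ (iGLS y (k + 1)) y

/-- `β̂_k` is well defined: all the matrices that are inverted in the construction of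
`β̂_1, …, β̂_k` are invertible. -/
def IGLSWellDefined (y : O → ℝ) : ℕ → Prop
  | 0 => False
  | 1 => IsUnit ((Ao * F)ᵀ * (Ao * F))
  | k + 2 => IGLSWellDefined y (k + 1) ∧ GLSWellDefined Ao F γ (iGLS Ao F γ y (k + 1))

end Estimators

/-- `X_m = o_P(a_m)` as `m → ∞`: for every `ε > 0`, `P(‖X_m‖ > ε a_m) → 0`, with the Euclidean
norm on `ℝ^p`. -/
def IsLittleOP [MeasurableSpace Ω] (P : Measure Ω) (X : ℕ → Ω → (Fin p → ℝ)) (a : ℕ → ℝ) : Prop :=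
  ∀ ε : ℝ, 0 < ε →
    Tendsto (fun m => P {ω | ε * a m < ‖WithLp.toLp 2 (X m ω)‖}) atTop (𝓝 0)

end NetworkTraffic

end

/-! The averaged observation is A_o F β plus a fixed matrix times the averaged noise. This separates
the analysis of the estimators as functions of y near A_o F β from the probabilistic study of the
noise average.

Analysis. Whenever its inverses exist, the GLS matrix H(b) satisfies H(b) A_o F = 1. Hence every
such estimator maps A_o F β to β, and continuity of matrix inversion makes all iterates consistent
(`tendsto_iGLS`). Moreover, two GLS estimates differ by (H(b) - H(c))(y - A_o F β). With b a
consistent iterate and c = β, the first factor tends to zero, so the difference is of smaller order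
than the observation error (`isLittleO_iGLS_sub_glsEstimate`). The OLS start is not of this form,
hence k ≥ 2.

Probability. Each coordinate of the noise average has variance σ_m²/σ², which tends to zero by a
Cesàro argument; so the average tends to zero in mean. By stationarity it is a Birkhoff average of a
shift, and the maximal ergodic theorem upgrades mean convergence to almost sure convergence
(`ae_tendsto_birkhoffAverage_zero`). Chebyshev's inequality bounds the noise average by O_P(σ_m),
which turns little-o into o_P(σ_m).

The variance formula is the sandwich identity H V Hᵗ = Σ_GLS at b = β, with V the inverse of G. -/

/-! ### Birkhoff averages: from convergence in mean to convergence almost everywhere. -/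

section Ergodic

variable {α : Type*} {T : α → α} {f : α → ℝ}

/-- The running maximum `max (0, S₁ f, …, S_N f)` of the Birkhoff sums of `f`. -/
def birkhoffMax (T : α → α) (f : α → ℝ) : ℕ → α → ℝ
  | 0, _ => 0
  | n + 1, x => max 0 (f x + birkhoffMax T f n (T x))

lemma birkhoffMax_nonneg (T : α → α) (f : α → ℝ) (n : ℕ) (x : α) : 0 ≤ birkhoffMax T f n x := by
  cases n with
  | zero => exact le_rfl
  | succ n => exact le_max_left _ _

lemma birkhoffMax_le_succ (T : α → α) (f : α → ℝ) (n : ℕ) (x : α) :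
    birkhoffMax T f n x ≤ birkhoffMax T f (n + 1) x := by
  induction n generalizing x with
  | zero => exact birkhoffMax_nonneg T f 1 x
  | succ n ih => exact max_le_max le_rfl (by linarith [ih (T x)])

lemma birkhoffSum_le_birkhoffMax (T : α → α) (f : α → ℝ) (n : ℕ) (x : α) :
    birkhoffSum T f n x ≤ birkhoffMax T f n x := by
  induction n generalizing x with
  | zero => simp [birkhoffMax]
  | succ n ih =>
    rw [birkhoffSum_succ']
    exact le_max_of_le_right (by linarith [ih (T x)])

/-- Garsia's inequality: where the maximum is positive it is attained by a nonempty sum, that is, by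
f x plus a maximum at T x over fewer terms; elsewhere the left side is at most zero. -/
lemma birkhoffMax_sub_le_indicator (T : α → α) (f : α → ℝ) (n : ℕ) (x : α) :
    birkhoffMax T f n x - birkhoffMax T f n (T x) ≤
      {x | 0 < birkhoffMax T f n x}.indicator f x := by
  by_cases hx : 0 < birkhoffMax T f n x
  · rw [Set.indicator_of_mem (by exact hx)]
    cases n with
    | zero => simp [birkhoffMax] at hx
    | succ n =>
      have h := birkhoffMax_le_succ T f n (T x)
      have : birkhoffMax T f (n + 1) x ≤ f x + birkhoffMax T f n (T x) := by
        rw [birkhoffMax] at hx ⊢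
        rcases lt_max_iff.1 hx with h0 | h0
        · exact absurd h0 (lt_irrefl _)
        · exact max_le h0.le le_rfl
      linarith
  · rw [Set.indicator_of_notMem (by exact hx)]
    linarith [birkhoffMax_nonneg T f n (T x), not_lt.1 hx]

/-- The points where the upper limit of the Birkhoff averages exceeds `ε`. -/
def upperBirkhoffSet (T : α → α) (f : α → ℝ) (ε : ℝ) : Set α :=
  {x | ∃ k : ℕ, ∃ᶠ n : ℕ in atTop, n * (ε + 1 / (k + 1)) < birkhoffSum T f n x}

lemma mem_upperBirkhoffSet_of_frequently {ε q : ℝ} (hq : ε < q) {x : α}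
    (h : ∃ᶠ n : ℕ in atTop, n * q < birkhoffSum T f n x) : x ∈ upperBirkhoffSet T f ε := by
  obtain ⟨k, hk⟩ := exists_nat_one_div_lt (sub_pos.2 hq)
  refine ⟨k, h.mono fun n hn => lt_of_le_of_lt ?_ hn⟩
  exact mul_le_mul_of_nonneg_left (by linarith) (Nat.cast_nonneg n)

lemma frequently_lt_of_frequently_lt_add {u : ℕ → ℝ} {c q q' : ℝ} (hq : q' < q)
    (h : ∃ᶠ n : ℕ in atTop, n * q < u n + c) : ∃ᶠ n : ℕ in atTop, n * q' < u n := by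
  have h1 : ∀ᶠ n : ℕ in atTop, c ≤ n * (q - q') :=
    (tendsto_natCast_atTop_atTop.atTop_mul_const (sub_pos.2 hq)).eventually_ge_atTop c
  exact (h.and_eventually h1).mono fun n hn => by nlinarith [hn.1, hn.2]

/-- The sums of length n at T x and n + 1 at x differ by f x, which does not depend on n, and the
margin 1 / (k + 1) absorbs it. Invariance is thus exact, and T preserves the restricted measure. -/
lemma preimage_upperBirkhoffSet (T : α → α) (f : α → ℝ) (ε : ℝ) :
    T ⁻¹' upperBirkhoffSet T f ε = upperBirkhoffSet T f ε := by
  have key (k : ℕ) : ∃ q q' : ℝ, ε < q' ∧ q' < q ∧ q < ε + 1 / (k + 1) := by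
    have : (0 : ℝ) < 1 / (k + 1) := Nat.one_div_pos_of_nat
    exact ⟨ε + 2 / 3 * (1 / (k + 1)), ε + 1 / 3 * (1 / (k + 1)), by linarith, by linarith,
      by linarith⟩
  ext x
  constructor
  · rintro ⟨k, hk⟩
    obtain ⟨q, q', h1, h2, h3⟩ := key k
    refine mem_upperBirkhoffSet_of_frequently h1 ?_
    -- Subtracting `q'` in `u` supplies the extra unit needed to pass from `n * q'` to `(n + 1) *
    -- q'`.
    have := frequently_lt_of_frequently_lt_add (q' := q')
      (u := fun n => birkhoffSum T f (n + 1) x - q') (c := q' - f x) (h2.trans h3)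
      (hk.mono fun n hn => by rw [birkhoffSum_succ']; linarith)
    exact (tendsto_add_atTop_nat 1).frequently (this.mono fun n hn => by push_cast; linarith)
  · rintro ⟨k, hk⟩
    obtain ⟨q, q', h1, h2, h3⟩ := key k
    refine mem_upperBirkhoffSet_of_frequently h1 ?_
    have h4 : ∃ᶠ n : ℕ in atTop, ((n + 1 : ℕ) : ℝ) * (ε + 1 / (k + 1)) <
        birkhoffSum T f (n + 1) x := by
      rw [frequently_atTop] at hk ⊢
      intro N
      obtain ⟨n, hn, h⟩ := hk (N + 1)
      exact ⟨n - 1, by omega, by rwa [Nat.sub_add_cancel (by omega)]⟩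
    refine frequently_lt_of_frequently_lt_add (h2.trans h3)
      (c := f x - (ε + 1 / (k + 1))) (h4.mono fun n hn => ?_)
    rw [birkhoffSum_succ'] at hn
    push_cast at hn
    linarith

variable [MeasurableSpace α] {μ : Measure α}

lemma measurable_birkhoffMax (hT : Measurable T) (hf : Measurable f) (n : ℕ) :
    Measurable (birkhoffMax T f n) := by
  induction n with
  | zero => exact measurable_const
  | succ n ih => exact measurable_const.max (hf.add (ih.comp hT))

lemma integrable_birkhoffMax (hT : MeasurePreserving T μ μ) (hf : Integrable f μ) (n : ℕ) :
    Integrable (birkhoffMax T f n) μ := by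
  induction n with
  | zero => exact integrable_zero _ _ _
  | succ n ih => exact (integrable_zero _ _ _).sup (hf.add (hT.integrable_comp_of_integrable ih))

lemma MeasureTheory.MeasurePreserving.integral_comp_of_aestronglyMeasurable
    (hT : MeasurePreserving T μ μ) (hf : AEStronglyMeasurable f μ) :
    ∫ x, f (T x) ∂μ = ∫ x, f x ∂μ := by
  conv_rhs => rw [← hT.map_eq]
  rw [integral_map hT.measurable.aemeasurable (by rwa [hT.map_eq])]

/-- The maximal ergodic theorem. -/
theorem integral_nonneg_of_ae_exists_birkhoffSum_pos (hT : MeasurePreserving T μ μ)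
    (hf : Measurable f) (hint : Integrable f μ)
    (hpos : ∀ᵐ x ∂μ, ∃ n, 0 < birkhoffSum T f n x) : 0 ≤ ∫ x, f x ∂μ := by
  have hmeas (n : ℕ) : MeasurableSet {x | 0 < birkhoffMax T f n x} :=
    measurableSet_lt measurable_const (measurable_birkhoffMax hT.measurable hf n)
  -- The sets where the maximum is positive exhaust almost the whole space, so integrals of f over
  -- them recover the full one. Each is nonnegative: integrate Garsia's inequality, whose left side
  -- has integral zero by invariance.
  have hlim : Tendsto (fun n => ∫ x, {x | 0 < birkhoffMax T f n x}.indicator f x ∂μ) atTop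
      (𝓝 (∫ x, f x ∂μ)) := by
    refine tendsto_integral_of_dominated_convergence (fun x => |f x|)
      (fun n => (hf.indicator (hmeas n)).aestronglyMeasurable) hint.abs
      (fun n => ae_of_all _ fun x => norm_indicator_le_norm_self _ _) ?_
    filter_upwards [hpos] with x ⟨n, hn⟩
    refine tendsto_const_nhds.congr' ?_
    filter_upwards [eventually_ge_atTop n] with k hk
    rw [Set.indicator_of_mem]
    exact hn.trans_le ((birkhoffSum_le_birkhoffMax T f n x).trans
      (monotone_nat_of_le_succ (f := fun n => birkhoffMax T f n x)
        (fun n => birkhoffMax_le_succ T f n x) hk))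
  refine ge_of_tendsto' hlim fun n => ?_
  have hM := integrable_birkhoffMax hT hint n
  have hMT : Integrable (fun x => birkhoffMax T f n (T x)) μ := hT.integrable_comp_of_integrable hM
  calc 0 = ∫ x, (birkhoffMax T f n x - birkhoffMax T f n (T x)) ∂μ := by
        rw [integral_sub hM hMT,
          hT.integral_comp_of_aestronglyMeasurable hM.aestronglyMeasurable, sub_self]
    _ ≤ _ := integral_mono (hM.sub hMT) (hint.indicator (hmeas n))
        (birkhoffMax_sub_le_indicator T f n)

lemma measurable_birkhoffSum (hT : Measurable T) (hf : Measurable f) (n : ℕ) :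
    Measurable (birkhoffSum T f n) :=
  Finset.measurable_sum _ fun k _ => hf.comp (hT.iterate k)

lemma measurableSet_upperBirkhoffSet (hT : Measurable T) (hf : Measurable f) (ε : ℝ) :
    MeasurableSet (upperBirkhoffSet T f ε) := by
  simp only [upperBirkhoffSet, frequently_atTop, Set.ofPred_exists, Set.ofPred_forall,
    Set.ofPred_and]
  exact .iUnion fun k => .iInter fun N => .iUnion fun n => (MeasurableSet.const _).inter
    (measurableSet_lt measurable_const (measurable_birkhoffSum hT hf n))

lemma setIntegral_birkhoffSum {B : Set α} (hT : MeasurePreserving T (μ.restrict B) (μ.restrict B))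
    (hint : IntegrableOn f B μ) (n : ℕ) :
    ∫ x in B, birkhoffSum T f n x ∂μ = n * ∫ x in B, f x ∂μ := by
  simp only [birkhoffSum]
  rw [integral_finsetSum (f := fun k x => f (T^[k] x)) _
    fun k _ => (hT.iterate k).integrable_comp_of_integrable hint]
  simp [(hT.iterate _).integral_comp_of_aestronglyMeasurable hint.aestronglyMeasurable]

/-- Work on the invariant set B. There f and its Birkhoff averages have the same integral, so
convergence in mean forces ∫_B f ≤ 0, while the maximal ergodic theorem for f - ε gives ε μ(B) ≤ ∫_B
f. -/
lemma measure_upperBirkhoffSet_eq_zero [IsFiniteMeasure μ] (hT : MeasurePreserving T μ μ)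
    (hf : Measurable f) (hint : Integrable f μ)
    (hmean : Tendsto (fun n => ∫ x, |birkhoffAverage ℝ T f n x| ∂μ) atTop (𝓝 0))
    {ε : ℝ} (hε : 0 < ε) : μ (upperBirkhoffSet T f ε) = 0 := by
  set B := upperBirkhoffSet T f ε with hBdef
  have hB : MeasurableSet B := measurableSet_upperBirkhoffSet hT.measurable hf ε
  have hTB : MeasurePreserving T (μ.restrict B) (μ.restrict B) := by
    have := hT.restrict_preimage hB
    rwa [preimage_upperBirkhoffSet] at this
  have hle : ∫ x in B, f x ∂μ ≤ 0 := by
    refine ge_of_tendsto hmean ?_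
    filter_upwards [eventually_gt_atTop 0] with n hn
    have hS : Integrable (birkhoffAverage ℝ T f n) μ :=
      (integrable_finsetSum _ fun k _ =>
        (hT.iterate k).integrable_comp_of_integrable hint).const_mul _
    calc ∫ x in B, f x ∂μ = ∫ x in B, birkhoffAverage ℝ T f n x ∂μ := by
          simp only [birkhoffAverage, smul_eq_mul]
          rw [integral_const_mul, setIntegral_birkhoffSum hTB hint.integrableOn]
          field_simp
      _ ≤ ∫ x in B, |birkhoffAverage ℝ T f n x| ∂μ :=
          integral_mono hS.integrableOn hS.abs.integrableOn fun x => le_abs_self _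
      _ ≤ ∫ x, |birkhoffAverage ℝ T f n x| ∂μ :=
          setIntegral_le_integral hS.abs (ae_of_all _ fun x => abs_nonneg _)
  have hge : 0 ≤ ∫ x in B, (f x - ε) ∂μ := by
    refine integral_nonneg_of_ae_exists_birkhoffSum_pos hTB (hf.sub_const ε)
      (hint.integrableOn.sub (integrable_const ε)) ?_
    filter_upwards [ae_restrict_mem hB] with x hx
    obtain ⟨k, hk⟩ := hx
    obtain ⟨n, hn⟩ := hk.exists
    refine ⟨n, ?_⟩
    have : birkhoffSum T (fun x => f x - ε) n x = birkhoffSum T f n x - n * ε := by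
      simp [birkhoffSum, Finset.sum_sub_distrib]
    rw [this, sub_pos]
    refine lt_of_le_of_lt ?_ hn
    have : (0 : ℝ) < 1 / (k + 1) := Nat.one_div_pos_of_nat
    exact mul_le_mul_of_nonneg_left (by linarith) (Nat.cast_nonneg n)
  rw [integral_sub hint.integrableOn (integrable_const ε)] at hge
  simp only [integral_const, measureReal_restrict_apply_univ, smul_eq_mul] at hge
  have h0 : μ.real B = 0 := by
    nlinarith [measureReal_nonneg (μ := μ) (s := B)]
  exact (measureReal_eq_zero_iff).1 h0

/-- If the Birkhoff averages converge to zero in mean, then they converge to zero almost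
everywhere. -/
theorem ae_tendsto_birkhoffAverage_zero [IsFiniteMeasure μ] (hT : MeasurePreserving T μ μ)
    (hf : Measurable f) (hint : Integrable f μ)
    (hmean : Tendsto (fun n => ∫ x, |birkhoffAverage ℝ T f n x| ∂μ) atTop (𝓝 0)) :
    ∀ᵐ x ∂μ, Tendsto (fun n => birkhoffAverage ℝ T f n x) atTop (𝓝 0) := by
  have hneg (n : ℕ) (x : α) : birkhoffSum T (-f) n x = -birkhoffSum T f n x := by
    simp [birkhoffSum]
  have h1 (k : ℕ) : ∀ᵐ x ∂μ, x ∉ upperBirkhoffSet T f (1 / (k + 1)) :=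
    measure_eq_zero_iff_ae_notMem.1
      (measure_upperBirkhoffSet_eq_zero hT hf hint hmean Nat.one_div_pos_of_nat)
  have h2 (k : ℕ) : ∀ᵐ x ∂μ, x ∉ upperBirkhoffSet T (-f) (1 / (k + 1)) :=
    measure_eq_zero_iff_ae_notMem.1
      (measure_upperBirkhoffSet_eq_zero hT hf.neg hint.neg
        (by simpa only [birkhoffAverage, hneg, smul_neg, abs_neg] using hmean) Nat.one_div_pos_of_nat)
  filter_upwards [ae_all_iff.2 h1, ae_all_iff.2 h2] with x hx1 hx2
  rw [Metric.tendsto_nhds]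
  intro ε hε
  -- Negating the strict inequality leaves a weak bound at rate ε / 2, hence a strict one at rate ε.
  obtain ⟨k, hk⟩ := exists_nat_one_div_lt (half_pos hε)
  have g1 := not_frequently.1 (mt (mem_upperBirkhoffSet_of_frequently hk) (hx1 k))
  have g2 := not_frequently.1 (mt (mem_upperBirkhoffSet_of_frequently hk) (hx2 k))
  filter_upwards [g1, g2, eventually_gt_atTop 0] with n hn1 hn2 hn
  rw [hneg] at hn2
  have hn' : (0 : ℝ) < n := Nat.cast_pos.2 hn
  rw [Real.dist_eq, sub_zero, birkhoffAverage, smul_eq_mul, abs_mul, abs_inv, Nat.abs_cast,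
    inv_mul_lt_iff₀ hn', abs_lt]
  constructor <;> nlinarith [mul_pos hn' hε]

end Ergodic

namespace NetworkTraffic

/-! ### The iterated GLS estimates as functions of the observation. -/

section Deterministic

open Asymptotics

variable {J O : Type*} {p : ℕ} [Fintype J] {Ao : Matrix O J ℝ} {F : Matrix J (Fin p) ℝ} {γ : ℝ}

lemma eventually_pos_mulVec {β : Fin p → ℝ} (hpos : ∀ j, 0 < (F *ᵥ β) j) :
    ∀ᶠ b in 𝓝 β, ∀ j, 0 < (F *ᵥ b) j := by
  refine eventually_all.2 fun j => ?_
  have hc : Continuous fun b : Fin p → ℝ => (F *ᵥ b) j :=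
    (continuous_apply j).comp (continuous_const.matrix_mulVec continuous_id)
  exact hc.continuousAt.eventually (lt_mem_nhds (hpos j))

lemma mulVec_injective_of_rank_eq [Finite O] {B : Matrix O (Fin p) ℝ} (h : B.rank = p) :
    Function.Injective B.mulVec := by
  rw [mulVec_injective_iff, linearIndependent_iff_card_eq_finrank_span, Set.finrank,
    ← B.rank_eq_finrank_span_cols, h, Fintype.card_fin]

section Gram

variable [Fintype O]

lemma vecMul_injective_of_rank_eq (h : Ao.rank = Fintype.card O) :
    Function.Injective Ao.vecMul := by
  rw [vecMul_injective_iff, linearIndependent_iff_card_eq_finrank_span, Set.finrank,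
    ← Ao.rank_eq_finrank_span_row, h]

lemma isUnit_olsGram (hcol : (Ao * F).rank = p) : IsUnit ((Ao * F)ᵀ * (Ao * F)) := by
  simpa using (PosDef.conjTranspose_mul_self (Ao * F) (mulVec_injective_of_rank_eq hcol)).isUnit

lemma olsEstimate_mulVec (hcol : (Ao * F).rank = p) (β : Fin p → ℝ) :
    olsEstimate Ao F ((Ao * F) *ᵥ β) = β := by
  rw [olsEstimate, mulVec_mulVec, Matrix.mul_assoc,
    nonsing_inv_mul _ ((isUnit_iff_isUnit_det _).1 (isUnit_olsGram hcol)), one_mulVec]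

lemma isLittleO_mulVec {n E : Type*} [Fintype n] {l : Filter E} {N : E → Matrix n O ℝ}
    (hN : Tendsto N l (𝓝 0)) (v : E → O → ℝ) : (fun x => N x *ᵥ v x) =o[l] v := by
  refine isLittleO_pi.2 fun a => ?_
  change (fun x => ∑ i, N x a i * v x i) =o[l] v
  refine IsLittleO.fun_sum fun i _ => ?_
  have h1 : (fun x => N x a i) =o[l] fun _ => (1 : ℝ) := by
    rw [isLittleO_one_iff]
    exact ((continuous_apply i).tendsto _).comp (((continuous_apply a).tendsto _).comp hN)
  have h2 : (fun x => v x i) =O[l] fun x => ‖v x‖ :=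
    .of_bound 1 (.of_forall fun x => by simpa using norm_le_pi_norm (v x) i)
  simpa using (h1.mul_isBigO h2).norm_right

end Gram

variable [DecidableEq J]

lemma continuous_linkCov (hγ : 0 < γ) : Continuous (linkCov Ao F γ) := by
  refine (continuous_const.matrix_mul (Continuous.matrix_diagonal ?_)).matrix_mul continuous_const
  refine continuous_pi fun j => Continuous.rpow_const ?_ fun _ => Or.inr (by positivity)
  exact ((continuous_apply j).comp (continuous_const.matrix_mulVec continuous_id)).abs

variable [Fintype O]

lemma posDef_linkCov (hrow : Ao.rank = Fintype.card O) {b : Fin p → ℝ}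
    (hb : ∀ j, 0 < (F *ᵥ b) j) : (linkCov Ao F γ b).PosDef := by
  have hD : (diagonal fun j => |(F *ᵥ b) j| ^ (2 * γ)).PosDef :=
    posDef_diagonal_iff.2 fun j => Real.rpow_pos_of_pos (abs_pos.2 (hb j).ne') _
  simpa [linkCov] using hD.mul_mul_conjTranspose_same (vecMul_injective_of_rank_eq hrow)

variable [DecidableEq O]

lemma posDef_glsGram (hrow : Ao.rank = Fintype.card O) (hcol : (Ao * F).rank = p)
    {b : Fin p → ℝ} (hb : ∀ j, 0 < (F *ᵥ b) j) : (glsGram Ao F γ b).PosDef := by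
  simpa [glsGram, G] using (posDef_linkCov (γ := γ) hrow hb).inv.conjTranspose_mul_mul_same
    (mulVec_injective_of_rank_eq hcol)

lemma glsWellDefined_of_pos (hrow : Ao.rank = Fintype.card O) (hcol : (Ao * F).rank = p)
    {b : Fin p → ℝ} (hb : ∀ j, 0 < (F *ᵥ b) j) : GLSWellDefined Ao F γ b :=
  ⟨(posDef_linkCov hrow hb).isUnit, (posDef_glsGram hrow hcol hb).isUnit⟩

lemma continuousAt_inv_of_isUnit {n : Type*} [Fintype n] [DecidableEq n] {M : Matrix n n ℝ}
    (h : IsUnit M) : ContinuousAt Inv.inv M := by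
  refine continuousAt_matrix_inv M ?_
  rw [Ring.inverse_eq_inv']
  exact continuousAt_inv₀ ((isUnit_iff_isUnit_det M).1 h).ne_zero

lemma continuousAt_G (hγ : 0 < γ) {b : Fin p → ℝ} (h : GLSWellDefined Ao F γ b) :
    ContinuousAt (G Ao F γ) b :=
  ContinuousAt.comp (g := Inv.inv) (continuousAt_inv_of_isUnit h.1)
    (continuous_linkCov hγ).continuousAt

lemma continuousAt_SigmaGLS (hγ : 0 < γ) {b : Fin p → ℝ} (h : GLSWellDefined Ao F γ b) :
    ContinuousAt (SigmaGLS Ao F γ) b := by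
  refine ContinuousAt.comp (g := Inv.inv) (continuousAt_inv_of_isUnit h.2) ?_
  have hc : Continuous fun M : Matrix O O ℝ => (Ao * F)ᵀ * M * (Ao * F) := by fun_prop
  exact hc.continuousAt.comp (continuousAt_G hγ h)

variable (Ao F γ) in
/-- The matrix of the linear map `glsEstimate Ao F γ b`. -/
noncomputable def glsMatrix (b : Fin p → ℝ) : Matrix (Fin p) O ℝ :=
  SigmaGLS Ao F γ b * (Ao * F)ᵀ * G Ao F γ b

lemma glsEstimate_eq (b : Fin p → ℝ) (y : O → ℝ) :
    glsEstimate Ao F γ b y = glsMatrix Ao F γ b *ᵥ y := rfl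

lemma continuousAt_glsMatrix (hγ : 0 < γ) {b : Fin p → ℝ} (h : GLSWellDefined Ao F γ b) :
    ContinuousAt (glsMatrix Ao F γ) b := by
  have hc : Continuous fun M : Matrix (Fin p) (Fin p) ℝ × Matrix O O ℝ =>
      M.1 * (Ao * F)ᵀ * M.2 := by fun_prop
  exact ContinuousAt.comp (f := fun b => (SigmaGLS Ao F γ b, G Ao F γ b))
    (g := fun M : Matrix (Fin p) (Fin p) ℝ × Matrix O O ℝ => M.1 * (Ao * F)ᵀ * M.2)
    hc.continuousAt ((continuousAt_SigmaGLS hγ h).prodMk (continuousAt_G hγ h))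

/-- Unbiasedness: the factors following `SigmaGLS` reassemble to the Gram matrix that it inverts. -/
lemma glsMatrix_mul {b : Fin p → ℝ} (h : GLSWellDefined Ao F γ b) :
    glsMatrix Ao F γ b * (Ao * F) = 1 := by
  rw [glsMatrix, Matrix.mul_assoc, Matrix.mul_assoc, ← Matrix.mul_assoc _ _ (Ao * F)]
  exact nonsing_inv_mul _ ((isUnit_iff_isUnit_det _).1 h.2)

lemma glsEstimate_mulVec {b : Fin p → ℝ} (h : GLSWellDefined Ao F γ b) (β : Fin p → ℝ) :
    glsEstimate Ao F γ b ((Ao * F) *ᵥ β) = β := by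
  rw [glsEstimate_eq, mulVec_mulVec, glsMatrix_mul h, one_mulVec]

/-- Both matrices are left inverses of A_o F, so their difference annihilates A_o F β, which may be
subtracted from y. -/
lemma glsEstimate_sub_glsEstimate {b c : Fin p → ℝ} (hb : GLSWellDefined Ao F γ b)
    (hc : GLSWellDefined Ao F γ c) (β : Fin p → ℝ) (y : O → ℝ) :
    glsEstimate Ao F γ b y - glsEstimate Ao F γ c y =
      (glsMatrix Ao F γ b - glsMatrix Ao F γ c) *ᵥ (y - (Ao * F) *ᵥ β) := by
  rw [mulVec_sub, sub_mulVec, mulVec_mulVec, Matrix.sub_mul, glsMatrix_mul hb, glsMatrix_mul hc,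
    sub_self, zero_mulVec, sub_zero, glsEstimate_eq, glsEstimate_eq]

/-- Consistency of the iterated GLS estimates, as functions of the observation. -/
theorem tendsto_iGLS (hrow : Ao.rank = Fintype.card O) (hcol : (Ao * F).rank = p) (hγ : 0 < γ)
    {β : Fin p → ℝ} (hpos : ∀ j, 0 < (F *ᵥ β) j) (k : ℕ) :
    Tendsto (fun y => iGLS Ao F γ y (k + 1)) (𝓝 ((Ao * F) *ᵥ β)) (𝓝 β) := by
  induction k with
  | zero =>
    have hc : Continuous (olsEstimate Ao F) := continuous_const.matrix_mulVec continuous_id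
    have := hc.tendsto ((Ao * F) *ᵥ β)
    rwa [olsEstimate_mulVec hcol] at this
  | succ k ih =>
    have hβ := glsWellDefined_of_pos (γ := γ) hrow hcol hpos
    have hc : Continuous fun M : Matrix (Fin p) O ℝ × (O → ℝ) => M.1 *ᵥ M.2 :=
      continuous_fst.matrix_mulVec continuous_snd
    have := (hc.tendsto (glsMatrix Ao F γ β, (Ao * F) *ᵥ β)).comp
      (((continuousAt_glsMatrix hγ hβ).tendsto.comp ih).prodMk_nhds tendsto_id)
    rwa [← glsEstimate_eq, glsEstimate_mulVec hβ] at this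

theorem eventually_pos_iGLS (hrow : Ao.rank = Fintype.card O) (hcol : (Ao * F).rank = p)
    (hγ : 0 < γ) {β : Fin p → ℝ} (hpos : ∀ j, 0 < (F *ᵥ β) j) (k : ℕ) :
    ∀ᶠ y in 𝓝 ((Ao * F) *ᵥ β), ∀ j, 0 < (F *ᵥ iGLS Ao F γ y (k + 1)) j :=
  (tendsto_iGLS hrow hcol hγ hpos k).eventually (eventually_pos_mulVec hpos)

theorem eventually_iGLSWellDefined (hrow : Ao.rank = Fintype.card O) (hcol : (Ao * F).rank = p)
    (hγ : 0 < γ) {β : Fin p → ℝ} (hpos : ∀ j, 0 < (F *ᵥ β) j) (k : ℕ) :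
    ∀ᶠ y in 𝓝 ((Ao * F) *ᵥ β), IGLSWellDefined Ao F γ y (k + 1) := by
  induction k with
  | zero => exact .of_forall fun y => isUnit_olsGram hcol
  | succ k ih =>
    filter_upwards [ih, eventually_pos_iGLS hrow hcol hγ hpos k] with y h1 h2
    exact ⟨h1, glsWellDefined_of_pos hrow hcol h2⟩

/-- From the second iteration on, the iterated GLS estimate differs from the GLS estimate by
an error of smaller order than that of the observation. -/
theorem isLittleO_iGLS_sub_glsEstimate (hrow : Ao.rank = Fintype.card O)
    (hcol : (Ao * F).rank = p) (hγ : 0 < γ) {β : Fin p → ℝ} (hpos : ∀ j, 0 < (F *ᵥ β) j)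
    (k : ℕ) :
    (fun y => iGLS Ao F γ y (k + 2) - glsEstimate Ao F γ β y) =o[𝓝 ((Ao * F) *ᵥ β)]
      fun y => y - (Ao * F) *ᵥ β := by
  have hβ := glsWellDefined_of_pos (γ := γ) hrow hcol hpos
  have hN : Tendsto (fun y => glsMatrix Ao F γ (iGLS Ao F γ y (k + 1)) - glsMatrix Ao F γ β)
      (𝓝 ((Ao * F) *ᵥ β)) (𝓝 0) := by
    have := ((continuousAt_glsMatrix hγ hβ).tendsto.comp
      (tendsto_iGLS hrow hcol hγ hpos k)).sub_const (glsMatrix Ao F γ β)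
    rwa [sub_self] at this
  refine (isLittleO_mulVec hN fun y => y - (Ao * F) *ᵥ β).congr' ?_ .rfl
  filter_upwards [eventually_pos_iGLS hrow hcol hγ hpos k] with y hy
  exact (glsEstimate_sub_glsEstimate (glsWellDefined_of_pos hrow hcol hy) hβ β y).symm

/-- G cancels the link covariance, leaving Σ (A_o F)ᵗ Hᵗ, and (A_o F)ᵗ Hᵗ is the transpose of H A_o
F = 1. -/
lemma glsMatrix_mul_linkCov_mul_transpose {b : Fin p → ℝ} (h : GLSWellDefined Ao F γ b) :
    glsMatrix Ao F γ b * linkCov Ao F γ b * (glsMatrix Ao F γ b)ᵀ = SigmaGLS Ao F γ b := by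
  have hG : G Ao F γ b * linkCov Ao F γ b = 1 :=
    nonsing_inv_mul _ ((isUnit_iff_isUnit_det _).1 h.1)
  have h1 : glsMatrix Ao F γ b * linkCov Ao F γ b = SigmaGLS Ao F γ b * (Ao * F)ᵀ := by
    rw [glsMatrix, Matrix.mul_assoc, hG, Matrix.mul_one]
  rw [h1, Matrix.mul_assoc, ← transpose_mul, glsMatrix_mul h, transpose_one, Matrix.mul_one]

end Deterministic

/-! ### Time averages of the noise: second moments and the law of large numbers. -/

section TimeAverage

variable {Ω J : Type*}

/-- Passing from m to m + 1 adds a row and a column, each contributing r 1 + ⋯ + r m, and one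
diagonal term. -/
lemma sum_range_sum_range_dist (r : ℕ → ℝ) (m : ℕ) :
    ∑ k ∈ Finset.range m, ∑ l ∈ Finset.range m, r (((k : ℤ) - l).natAbs) =
      m * r 0 + 2 * ∑ i ∈ Finset.Ico 1 m, ((m : ℝ) - i) * r i := by
  induction m with
  | zero => simp
  | succ m ih =>
    have h1 : ∑ k ∈ Finset.range m, r (((k : ℤ) - m).natAbs) =
        ∑ i ∈ Finset.Ico 1 (m + 1), r i := by
      rw [Finset.sum_Ico_eq_sum_range, ← Finset.sum_range_reflect]
      refine Finset.sum_congr rfl fun k hk => ?_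
      have := Finset.mem_range.1 hk
      congr 1
      omega
    have h2 : ∑ l ∈ Finset.range m, r (((m : ℤ) - l).natAbs) =
        ∑ i ∈ Finset.Ico 1 (m + 1), r i := by
      rw [← h1]
      refine Finset.sum_congr rfl fun k hk => ?_
      rw [← Int.natAbs_neg, neg_sub]
    have h3 : ∑ i ∈ Finset.Ico 1 (m + 1), (((m + 1 : ℕ) : ℝ) - i) * r i =
        ∑ i ∈ Finset.Ico 1 m, ((m : ℝ) - i) * r i + ∑ i ∈ Finset.Ico 1 (m + 1), r i := by
      rcases Nat.eq_zero_or_pos m with rfl | hm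
      · simp
      · rw [Finset.sum_Ico_succ_top hm, Finset.sum_Ico_succ_top hm, ← add_assoc,
          ← Finset.sum_add_distrib]
        push_cast
        congr 1
        · exact Finset.sum_congr rfl fun i _ => by ring
        · ring
    simp only [Finset.sum_range_succ, Finset.sum_add_distrib]
    rw [ih, h1, h2, h3]
    simp only [sub_self, Int.natAbs_zero]
    push_cast
    ring

/-- The weights 1 - i / m lie in [0, 1], so the Cesàro means of |ρ| dominate the sum. -/
lemma tendsto_sigmaSq (σ : ℝ) {ρ : ℕ → ℝ} (hρ : Tendsto ρ atTop (𝓝 0)) :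
    Tendsto (sigmaSq σ ρ) atTop (𝓝 0) := by
  have h1 : Tendsto (fun m : ℕ => σ ^ 2 * ((m : ℝ)⁻¹ + 2 * ((m : ℝ)⁻¹ *
      ∑ i ∈ Finset.range m, |ρ i|))) atTop (𝓝 0) := by
    have := ((tendsto_inv_atTop_nhds_zero_nat (𝕜 := ℝ)).add
      ((by simpa using hρ.abs : Tendsto (fun i => |ρ i|) atTop (𝓝 0)).cesaro.const_mul
        2)).const_mul (σ ^ 2)
    simpa using this
  refine squeeze_zero_norm (fun m => ?_) h1
  have h2 : |∑ i ∈ Finset.Ico 1 m, (1 - (i : ℝ) / m) * ρ i| ≤ ∑ i ∈ Finset.range m, |ρ i| := by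
    refine (Finset.abs_sum_le_sum_abs _ _).trans ?_
    refine (Finset.sum_le_sum fun i hi => ?_).trans
      (Finset.sum_le_sum_of_subset_of_nonneg (fun i hi => ?_) fun i _ _ => abs_nonneg (ρ i))
    · rw [abs_mul]
      refine mul_le_of_le_one_left (abs_nonneg _) ?_
      have him := (Finset.mem_Ico.1 hi).2
      have h0 : (0 : ℝ) ≤ i / m := by positivity
      have h1 : (i : ℝ) / m ≤ 1 := div_le_one_of_le₀ (by exact_mod_cast him.le) (by positivity)
      rw [abs_le]
      constructor <;> linarith
    · exact Finset.mem_range.2 (Finset.mem_Ico.1 hi).2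
  rw [sigmaSq, Real.norm_eq_abs, abs_mul, abs_div, abs_sq, Nat.abs_cast, div_eq_mul_inv, mul_assoc]
  refine mul_le_mul_of_nonneg_left ?_ (sq_nonneg σ)
  have h3 : |1 + 2 * ∑ i ∈ Finset.Ico 1 m, (1 - (i : ℝ) / m) * ρ i| ≤
      1 + 2 * ∑ i ∈ Finset.range m, |ρ i| := by
    refine (abs_add_le _ _).trans ?_
    rw [abs_one, abs_mul, abs_two]
    linarith
  refine (mul_le_mul_of_nonneg_left h3 (by positivity)).trans_eq ?_
  ring

lemma sigmaSq_eq (σ : ℝ) (ρ : ℕ → ℝ) (m : ℕ) : sigmaSq σ ρ m = σ ^ 2 * sigmaSq 1 ρ m := by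
  simp only [sigmaSq]
  ring

/-- The time average of the noise. -/
noncomputable def noiseMean (Z : ℤ → Ω → (J → ℝ)) (t₀ : ℤ) (m : ℕ) (ω : Ω) (j : J) : ℝ :=
  (1 / (m : ℝ)) * ∑ k ∈ Finset.range m, Z (t₀ - (k : ℤ)) ω j

lemma obsMean_linkTraffic {L : Type*} [Fintype J] [DecidableEq J] {p : ℕ}
    (A : Matrix L J ℝ) (O : Finset L) (F : Matrix J (Fin p) ℝ) (β : Fin p → ℝ) (σ γ : ℝ)
    (Z : ℤ → Ω → (J → ℝ)) (t₀ : ℤ) {m : ℕ} (hm : m ≠ 0) (ω : Ω) :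
    obsMean O (linkTraffic A F β σ γ Z) t₀ m ω = (obsRows A O * F) *ᵥ β +
      (σ • (obsRows A O * diagonal fun j => |(F *ᵥ β) j| ^ γ)) *ᵥ noiseMean Z t₀ m ω := by
  have hm' : (m : ℝ) ≠ 0 := Nat.cast_ne_zero.2 hm
  ext l
  have hF : ((A * F) *ᵥ β) l = ((obsRows A O * F) *ᵥ β) l := rfl
  simp only [obsMean, linkTraffic, Pi.add_apply, Pi.smul_apply, Finset.sum_add_distrib,
    Finset.sum_const, Finset.card_range, smul_mulVec, mulVec, dotProduct, smul_eq_mul,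
    nsmul_eq_mul, mul_add]
  congr 1
  · field_simp
    exact hF
  · simp only [noiseMean, mul_diagonal, obsRows, submatrix_apply, id, Finset.mul_sum]
    rw [Finset.sum_comm]
    exact Finset.sum_congr rfl fun j _ => Finset.sum_congr rfl fun k _ => by ring

variable [MeasurableSpace Ω] [Fintype J] {P : Measure Ω} {Z : ℤ → Ω → (J → ℝ)} {ρ : ℕ → ℝ}

namespace IsStationaryGaussianNoise

lemma hasLaw_apply (hZ : IsStationaryGaussianNoise P Z ρ) (t : ℤ) (j : J) :
    HasLaw (fun ω => Z t ω j) (gaussianReal 0 1) P :=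
  (measurePreserving_eval (fun _ : J => gaussianReal 0 1) j).fun_comp_hasLaw (hZ.marginal t)

lemma memLp (hZ : IsStationaryGaussianNoise P Z ρ) (t : ℤ) (j : J) :
    MemLp (fun ω => Z t ω j) 2 P := by
  have h := hZ.hasLaw_apply t j
  have := memLp_id_gaussianReal (μ := 0) (v := 1) 2
  rw [← h.map_eq] at this
  exact this.comp_of_map h.aemeasurable

lemma integral_eq_zero (hZ : IsStationaryGaussianNoise P Z ρ) (t : ℤ) (j : J) :
    ∫ ω, Z t ω j ∂P = 0 := by
  rw [(hZ.hasLaw_apply t j).integral_eq, integral_id_gaussianReal]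

lemma rho_zero (hZ : IsStationaryGaussianNoise P Z ρ) (j : J) : ρ 0 = 1 := by
  rw [← hZ.temporal j 0 0]
  simp only [Nat.cast_zero, add_zero]
  rw [covariance_self (hZ.hasLaw_apply 0 j).aemeasurable, (hZ.hasLaw_apply 0 j).variance_eq,
    variance_id_gaussianReal]
  simp

lemma covariance_apply (hZ : IsStationaryGaussianNoise P Z ρ) (j : J) (s t : ℤ) :
    cov[fun ω => Z s ω j, fun ω => Z t ω j; P] = ρ (s - t).natAbs := by
  rcases le_total s t with h | h
  · rw [← hZ.temporal j s]
    congr! 3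
    omega
  · rw [← hZ.temporal j t, covariance_comm]
    congr! 3
    omega

lemma memLp_noiseMean (hZ : IsStationaryGaussianNoise P Z ρ) (t₀ : ℤ) (m : ℕ) (j : J) :
    MemLp (fun ω => noiseMean Z t₀ m ω j) 2 P :=
  (memLp_finsetSum (Finset.range m) fun k _ => hZ.memLp (t₀ - (k : ℤ)) j).const_mul (1 / (m : ℝ))

lemma integral_noiseMean [IsProbabilityMeasure P] (hZ : IsStationaryGaussianNoise P Z ρ)
    (t₀ : ℤ) (m : ℕ) (j : J) : ∫ ω, noiseMean Z t₀ m ω j ∂P = 0 := by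
  simp only [noiseMean]
  rw [integral_const_mul, integral_finsetSum _ fun k _ => (hZ.memLp _ j).integrable one_le_two]
  simp [hZ.integral_eq_zero]

lemma covariance_noiseMean_eq_sum [IsProbabilityMeasure P]
    (hZ : IsStationaryGaussianNoise P Z ρ) (t₀ : ℤ) (m : ℕ) (i j : J) :
    cov[fun ω => noiseMean Z t₀ m ω i, fun ω => noiseMean Z t₀ m ω j; P] =
      (1 / (m : ℝ)) * ((1 / (m : ℝ)) * ∑ k ∈ Finset.range m, ∑ l ∈ Finset.range m,
        cov[fun ω => Z (t₀ - (k : ℤ)) ω i, fun ω => Z (t₀ - (l : ℤ)) ω j; P]) := by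
  simp only [noiseMean]
  rw [covariance_const_mul_left, covariance_const_mul_right, covariance_fun_sum_fun_sum'
    (fun k _ => hZ.memLp _ i) fun k _ => hZ.memLp _ j]

lemma variance_noiseMean [IsProbabilityMeasure P] (hZ : IsStationaryGaussianNoise P Z ρ)
    (t₀ : ℤ) (m : ℕ) (j : J) : Var[fun ω => noiseMean Z t₀ m ω j; P] = sigmaSq 1 ρ m := by
  rw [← covariance_self (hZ.memLp_noiseMean t₀ m j).aemeasurable, hZ.covariance_noiseMean_eq_sum]
  have h (k l : ℕ) : cov[fun ω => Z (t₀ - (k : ℤ)) ω j, fun ω => Z (t₀ - (l : ℤ)) ω j; P] =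
      ρ (((k : ℤ) - l).natAbs) := by
    rw [hZ.covariance_apply, ← Int.natAbs_neg]
    congr 2
    ring
  simp only [h]
  rw [sum_range_sum_range_dist, hZ.rho_zero j, sigmaSq]
  rcases eq_or_ne m 0 with rfl | hm
  -- For m = 0 both sides vanish, as division by zero gives zero.
  · simp
  · have hm' : (m : ℝ) ≠ 0 := Nat.cast_ne_zero.2 hm
    have h1 : ∑ i ∈ Finset.Ico 1 m, ((m : ℝ) - i) * ρ i =
        m * ∑ i ∈ Finset.Ico 1 m, (1 - (i : ℝ) / m) * ρ i := by
      rw [Finset.mul_sum]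
      exact Finset.sum_congr rfl fun i _ => by field_simp
    rw [h1]
    field_simp

lemma covariance_noiseMean_of_ne [IsProbabilityMeasure P]
    (hZ : IsStationaryGaussianNoise P Z ρ) (hcross : CrossUncorrelated P Z) (t₀ : ℤ) (m : ℕ)
    {i j : J} (hij : i ≠ j) :
    cov[fun ω => noiseMean Z t₀ m ω i, fun ω => noiseMean Z t₀ m ω j; P] = 0 := by
  rw [hZ.covariance_noiseMean_eq_sum]
  simp [hcross i j hij]

/-- The variance of the absolute value is nonnegative, and the mean itself is centred. -/
lemma integral_abs_noiseMean_le [IsProbabilityMeasure P] (hZ : IsStationaryGaussianNoise P Z ρ)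
    (t₀ : ℤ) (m : ℕ) (j : J) : ∫ ω, |noiseMean Z t₀ m ω j| ∂P ≤ √(sigmaSq 1 ρ m) := by
  have h := hZ.memLp_noiseMean t₀ m j
  refine Real.le_sqrt_of_sq_le ?_
  rw [← hZ.variance_noiseMean t₀ m j, variance_eq_sub h, hZ.integral_noiseMean]
  have := variance_nonneg (fun ω => |noiseMean Z t₀ m ω j|) P
  rw [variance_eq_sub (X := fun ω => |noiseMean Z t₀ m ω j|) h.abs] at this
  simp only [Pi.pow_apply, sq_abs] at this ⊢
  linarith

/-- The law of large numbers for a stationary Gaussian process with vanishing correlations. -/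
theorem ae_tendsto_noiseMean_apply [IsProbabilityMeasure P]
    (hZ : IsStationaryGaussianNoise P Z ρ) (hρ : Tendsto ρ atTop (𝓝 0)) (t₀ : ℤ) (j : J) :
    ∀ᵐ ω ∂P, Tendsto (fun m => noiseMean Z t₀ m ω j) atTop (𝓝 0) := by
  -- Transfer to path space: `ψ` reads coordinate j backwards from t₀, and stationarity under h = -1
  -- makes the one-sided shift `T` preserve its law. Birkhoff averages of the coordinate `f` are
  -- then the noise averages.
  let ψ : Ω → ℕ → ℝ := fun ω k => Z (t₀ - (k : ℤ)) ω j
  let T : (ℕ → ℝ) → ℕ → ℝ := fun w k => w (k + 1)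
  let f : (ℕ → ℝ) → ℝ := fun w => w 0
  have hψ : AEMeasurable ψ P := aemeasurable_pi_lambda _ fun k =>
    (hZ.hasLaw_apply (t₀ - (k : ℤ)) j).aemeasurable
  have hTm : Measurable T := measurable_pi_lambda _ fun k => measurable_pi_apply (k + 1)
  have hf : Measurable f := measurable_pi_apply 0
  have hT : MeasurePreserving T (P.map ψ) (P.map ψ) := by
    refine ⟨hTm, ?_⟩
    have hφ : Measurable fun (w : ℤ → J → ℝ) (k : ℕ) => w (t₀ - (k : ℤ)) j :=
      measurable_pi_lambda _ fun k => (measurable_pi_apply j).comp (measurable_pi_apply _)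
    have := ((hZ.stationary (-1)).comp hφ).map_eq
    rw [AEMeasurable.map_map_of_aemeasurable hTm.aemeasurable hψ]
    have hshift : T ∘ ψ = (fun (w : ℤ → J → ℝ) (k : ℕ) => w (t₀ - (k : ℤ)) j) ∘
        fun ω t => Z (t + -1) ω := by
      ext ω k
      simp only [T, ψ, Function.comp]
      rw [show t₀ - ((k + 1 : ℕ) : ℤ) = t₀ - k + -1 by push_cast; ring]
    rw [hshift]
    exact this
  have hiter (w : ℕ → ℝ) (k : ℕ) : T^[k] w = fun n => w (n + k) := by
    induction k generalizing w with
    | zero => rfl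
    | succ k ih =>
      rw [Function.iterate_succ_apply, ih]
      ext n
      simp only [T]
      congr 1
  have havg (m : ℕ) (ω : Ω) : birkhoffAverage ℝ T f m (ψ ω) = noiseMean Z t₀ m ω j := by
    simp [birkhoffAverage, birkhoffSum, hiter, f, ψ, noiseMean]
  have hint : Integrable f (P.map ψ) :=
    (integrable_map_measure hf.aestronglyMeasurable hψ).2
      ((hZ.memLp (t₀ - ((0 : ℕ) : ℤ)) j).integrable one_le_two)
  have hmeas (m : ℕ) : Measurable fun w => |birkhoffAverage ℝ T f m w| :=
    ((measurable_birkhoffSum hTm hf m).const_smul ((m : ℝ)⁻¹)).abs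
  have : IsProbabilityMeasure (P.map ψ) := Measure.isProbabilityMeasure_map hψ
  have h := ae_tendsto_birkhoffAverage_zero hT hf hint <| by
    refine squeeze_zero (fun m => integral_nonneg fun w => abs_nonneg _) (fun m => ?_)
      (by simpa using (tendsto_sigmaSq 1 hρ).sqrt)
    rw [integral_map hψ (hmeas m).aestronglyMeasurable]
    simp only [havg]
    exact hZ.integral_abs_noiseMean_le t₀ m j
  filter_upwards [ae_of_ae_map hψ h] with ω hω
  simpa only [havg] using hω

theorem ae_tendsto_noiseMean [IsProbabilityMeasure P]
    (hZ : IsStationaryGaussianNoise P Z ρ) (hρ : Tendsto ρ atTop (𝓝 0)) (t₀ : ℤ) :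
    ∀ᵐ ω ∂P, Tendsto (fun m => noiseMean Z t₀ m ω) atTop (𝓝 0) := by
  filter_upwards [ae_all_iff.2 (hZ.ae_tendsto_noiseMean_apply hρ t₀)] with ω hω
  exact tendsto_pi_nhds.2 hω

lemma measure_le_norm_noiseMean_le [IsProbabilityMeasure P]
    (hZ : IsStationaryGaussianNoise P Z ρ) (t₀ : ℤ) (m : ℕ) {c : ℝ} (hc : 0 < c) :
    P {ω | c ≤ ‖noiseMean Z t₀ m ω‖} ≤
      Fintype.card J * ENNReal.ofReal (sigmaSq 1 ρ m / c ^ 2) := by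
  have hsub : {ω | c ≤ ‖noiseMean Z t₀ m ω‖} ⊆ ⋃ j, {ω | c ≤ |noiseMean Z t₀ m ω j|} := by
    intro ω hω
    by_contra hcon
    simp only [Set.mem_iUnion, Set.mem_ofPred_eq, not_exists, not_le] at hcon
    exact absurd ((pi_norm_lt_iff hc).2 hcon) (not_lt.2 hω)
  refine (measure_mono hsub).trans ((measure_iUnion_fintype_le _ _).trans ?_)
  refine (Finset.sum_le_sum fun j _ => ?_).trans_eq
    (Finset.sum_const (ENNReal.ofReal (sigmaSq 1 ρ m / c ^ 2)) |>.trans (nsmul_eq_mul _ _))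
  have := meas_ge_le_variance_div_sq (hZ.memLp_noiseMean t₀ m j) hc
  simpa only [hZ.variance_noiseMean, hZ.integral_noiseMean, sub_zero] using this

end IsStationaryGaussianNoise

end TimeAverage

/-! ### Stochastic order of the errors and covariances of linear images of the noise. -/

section Estimation

open Asymptotics

variable {Ω J : Type*} [MeasurableSpace Ω] [Fintype J] {P : Measure Ω} [IsProbabilityMeasure P]
  {Z : ℤ → Ω → (J → ℝ)} {ρ : ℕ → ℝ}

/-- The normalized time averages of the noise are bounded in probability. -/
lemma IsStationaryGaussianNoise.measure_mul_sqrt_lt_norm_noiseMean_le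
    (hZ : IsStationaryGaussianNoise P Z ρ) (t₀ : ℤ) (m : ℕ) {K : ℝ} (hK : 0 < K) :
    P {ω | K * √(sigmaSq 1 ρ m) < ‖noiseMean Z t₀ m ω‖} ≤
      Fintype.card J * ENNReal.ofReal ((K ^ 2)⁻¹) := by
  rcases le_or_gt (sigmaSq 1 ρ m) 0 with hv | hv
  -- Chebyshev needs a positive threshold. In this degenerate case the average is almost surely
  -- zero, and the strict inequality makes the event null.
  · have h0 : ∀ᵐ ω ∂P, noiseMean Z t₀ m ω = 0 := by
      have hj (j : J) : ∀ᵐ ω ∂P, noiseMean Z t₀ m ω j = 0 := by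
        have hvar := hZ.variance_noiseMean t₀ m j
        have := ae_eq_integral_of_variance_eq_zero (hZ.memLp_noiseMean t₀ m j)
          (le_antisymm (hvar.trans_le hv) (variance_nonneg _ _))
        simpa only [hZ.integral_noiseMean] using this
      filter_upwards [ae_all_iff.2 hj] with ω hω
      exact funext hω
    have : P {ω | K * √(sigmaSq 1 ρ m) < ‖noiseMean Z t₀ m ω‖} = 0 := by
      refine measure_eq_zero_iff_ae_notMem.2 ?_
      filter_upwards [h0] with ω hω
      simp [hω, Real.sqrt_eq_zero_of_nonpos hv]
    rw [this]
    exact zero_le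
  · have hc : 0 < K * √(sigmaSq 1 ρ m) := mul_pos hK (Real.sqrt_pos.2 hv)
    refine (measure_mono fun ω hω => ?_).trans
      ((hZ.measure_le_norm_noiseMean_le t₀ m hc).trans_eq ?_)
    · have h : K * √(sigmaSq 1 ρ m) < ‖noiseMean Z t₀ m ω‖ := hω
      exact h.le
    · rw [mul_pow, Real.sq_sqrt hv.le]
      congr 2
      field_simp

/-- A quantity of smaller order than the time averages of the noise is `o_P(σ_m)`. -/
theorem IsStationaryGaussianNoise.isLittleOP_of_isLittleO {p : ℕ}
    (hZ : IsStationaryGaussianNoise P Z ρ) (hρ : Tendsto ρ atTop (𝓝 0)) (t₀ : ℤ)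
    {σ : ℝ} (hσ : 0 < σ) {g : (J → ℝ) → Fin p → ℝ} (hg : g =o[𝓝 0] fun z => z)
    {X : ℕ → Ω → Fin p → ℝ} (hX : ∀ᶠ m in atTop, ∀ ω, X m ω = g (noiseMean Z t₀ m ω)) :
    IsLittleOP P X fun m => √(sigmaSq σ ρ m) := by
  intro ε hε
  have hg' : (fun z => WithLp.toLp 2 (g z)) =o[𝓝 0] fun z => z :=
    (((PiLp.continuousLinearEquiv 2 ℝ fun _ : Fin p => ℝ).symm :
      (Fin p → ℝ) →L[ℝ] PiLp 2 fun _ : Fin p => ℝ).isBigO_comp g (𝓝 0)).trans_isLittleO hg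
  rw [ENNReal.tendsto_nhds_zero]
  intro η hη
  have hη2 : 0 < η / 2 := ENNReal.half_pos hη.ne'
  have hmul {ι : Type} {l : Filter ι} {u : ι → ℝ} (hu : Tendsto u l (𝓝 0)) :
      ∀ᶠ x in l, (Fintype.card J : ENNReal) * ENNReal.ofReal (u x) ≤ η / 2 := by
    have := ENNReal.Tendsto.const_mul (a := (Fintype.card J : ENNReal)) (ENNReal.tendsto_ofReal hu)
      (Or.inr (ENNReal.natCast_ne_top _))
    rw [ENNReal.ofReal_zero, mul_zero] at this
    exact ENNReal.tendsto_nhds_zero.1 this _ hη2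
  -- δ is fixed before m: the Chebyshev bound at level ε σ / δ does not depend on m and is small
  -- with δ.
  obtain ⟨δ, hδ, hδ0⟩ : ∃ δ : ℝ,
      (Fintype.card J : ENNReal) * ENNReal.ofReal (((ε * σ / δ) ^ 2)⁻¹) ≤ η / 2 ∧ 0 < δ := by
    have hc : Tendsto (fun δ : ℝ => ((ε * σ / δ) ^ 2)⁻¹) (𝓝[>] 0) (𝓝 0) := by
      have : Continuous fun δ : ℝ => (δ / (ε * σ)) ^ 2 := by fun_prop
      have := (this.tendsto 0).mono_left (nhdsWithin_le_nhds (s := Set.Ioi 0))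
      simpa [← inv_pow, inv_div] using this
    exact ((hmul hc).and self_mem_nhdsWithin).exists
  obtain ⟨r, hr, hball⟩ := Metric.eventually_nhds_iff.1 (hg'.bound hδ0)
  have hv : Tendsto (fun m => sigmaSq 1 ρ m / r ^ 2) atTop (𝓝 0) := by
    simpa using (tendsto_sigmaSq 1 hρ).div_const (r ^ 2)
  filter_upwards [hX, hmul hv] with m hXm hm
  -- Either the noise average leaves the ball where g is bounded by δ times the norm, or that bound
  -- forces it above the level ε σ / δ in units of its standard deviation.
  have hsub : {ω | ε * √(sigmaSq σ ρ m) < ‖WithLp.toLp 2 (X m ω)‖} ⊆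
      {ω | r ≤ ‖noiseMean Z t₀ m ω‖} ∪
        {ω | ε * σ / δ * √(sigmaSq 1 ρ m) < ‖noiseMean Z t₀ m ω‖} := by
    intro ω hω
    rw [Set.mem_union, or_iff_not_imp_left]
    intro hlt
    have hlt' : ‖noiseMean Z t₀ m ω‖ < r := not_le.1 hlt
    have h1 := hball (y := noiseMean Z t₀ m ω) (by rwa [dist_zero_right])
    rw [← hXm] at h1
    have h2 : ε * √(sigmaSq σ ρ m) < δ * ‖noiseMean Z t₀ m ω‖ := lt_of_lt_of_le hω h1
    rw [sigmaSq_eq, Real.sqrt_mul (sq_nonneg σ), Real.sqrt_sq hσ.le] at h2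
    change ε * σ / δ * √(sigmaSq 1 ρ m) < _
    rw [div_mul_eq_mul_div, div_lt_iff₀ hδ0]
    linarith
  refine (measure_mono hsub).trans ((measure_union_le _ _).trans ?_)
  refine (add_le_add ((hZ.measure_le_norm_noiseMean_le t₀ m hr).trans hm)
    ((hZ.measure_mul_sqrt_lt_norm_noiseMean_le t₀ m (by positivity)).trans hδ)).trans_eq ?_
  exact ENNReal.add_halves η

lemma memLp_add_mulVec {n : Type*} {z : Ω → J → ℝ} (hz : ∀ j, MemLp (fun ω => z ω j) 2 P)
    (c : n → ℝ) (N : Matrix n J ℝ) (a : n) : MemLp (fun ω => (c + N *ᵥ z ω) a) 2 P :=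
  (memLp_const (c a)).add (memLp_finsetSum Finset.univ fun j _ => (hz j).const_mul (N a j))

lemma covariance_add_mulVec [DecidableEq J] {n : Type*} {z : Ω → J → ℝ} {v : ℝ}
    (hz : ∀ j, MemLp (fun ω => z ω j) 2 P)
    (hcov : ∀ i j, cov[fun ω => z ω i, fun ω => z ω j; P] = if i = j then v else 0)
    (c : n → ℝ) (N : Matrix n J ℝ) (a b : n) :
    cov[fun ω => (c + N *ᵥ z ω) a, fun ω => (c + N *ᵥ z ω) b; P] = v * (N * Nᵀ) a b := by
  have hN (a : n) (j : J) : MemLp (fun ω => N a j * z ω j) 2 P := (hz j).const_mul _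
  have hint (a : n) : Integrable (fun ω => ∑ j, N a j * z ω j) P :=
    (memLp_finsetSum Finset.univ fun j _ => hN a j).integrable one_le_two
  simp only [Pi.add_apply, mulVec, dotProduct]
  rw [covariance_const_add_left (hint a), covariance_const_add_right (hint b),
    covariance_fun_sum_fun_sum (hN a) (hN b)]
  simp only [covariance_const_mul_left, covariance_const_mul_right, hcov, mul_ite, mul_zero,
    Finset.sum_ite_eq, Finset.mem_univ, if_true, mul_apply, transpose_apply, Finset.mul_sum]
  exact Finset.sum_congr rfl fun i _ => by ring

/-- Identifies the covariance of the link noise, up to scale, with the matrix inverted in `G`;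
positivity lets the powers add. -/
lemma mul_diagonal_mul_transpose_eq_linkCov [DecidableEq J] {O : Type*} {p : ℕ}
    (Ao : Matrix O J ℝ) (F : Matrix J (Fin p) ℝ) (γ : ℝ) {β : Fin p → ℝ}
    (hpos : ∀ j, 0 < (F *ᵥ β) j) :
    (Ao * diagonal fun j => |(F *ᵥ β) j| ^ γ) * (Ao * diagonal fun j => |(F *ᵥ β) j| ^ γ)ᵀ =
      linkCov Ao F γ β := by
  have h : ((diagonal fun j => |(F *ᵥ β) j| ^ γ) * diagonal fun j => |(F *ᵥ β) j| ^ γ) =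
      diagonal fun j => |(F *ᵥ β) j| ^ (2 * γ) := by
    rw [diagonal_mul_diagonal]
    congr 1
    ext j
    rw [two_mul, Real.rpow_add (abs_pos.2 (hpos j).ne')]
  rw [transpose_mul, diagonal_transpose, linkCov, ← h]
  simp only [Matrix.mul_assoc]

end Estimation

end NetworkTraffic

/-! ### The theorem: substituting the noise average into the estimators. -/

open NetworkTraffic in
theorem theorem1
    {Ω J L : Type*} [MeasurableSpace Ω] (P : Measure Ω) [IsProbabilityMeasure P]
    [Fintype J] [DecidableEq J] [Fintype L] [DecidableEq L] {p : ℕ}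
    (A : Matrix L J ℝ) (O : Finset L) (F : Matrix J (Fin p) ℝ) (β : Fin p → ℝ)
    (σ γ : ℝ) (hσ : 0 < σ) (hγ : 0 < γ)
    (Z : ℤ → Ω → (J → ℝ)) (ρ : ℕ → ℝ) (hZ : IsStationaryGaussianNoise P Z ρ)
    (hrow : (obsRows A O).rank = O.card)
    (hcol : (obsRows A O * F).rank = p)
    (hpos : ∀ j, 0 < (F *ᵥ β) j)
    (t₀ : ℤ) (Ybar : ℕ → Ω → (O → ℝ))
    (hYbar : Ybar = obsMean O (linkTraffic A F β σ γ Z) t₀)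
    (βhat : ℕ → ℕ → Ω → (Fin p → ℝ))
    (hβhat : βhat = fun k m ω => iGLS (obsRows A O) F γ (Ybar m ω) k)
    (βGLS : ℕ → Ω → (Fin p → ℝ))
    (hβGLS : βGLS = fun m ω => glsEstimate (obsRows A O) F γ β (Ybar m ω)) :
    (Tendsto ρ atTop (𝓝 0) →
      (∀ k, 1 ≤ k → ∀ᵐ ω ∂P, ∀ᶠ m in atTop,
        (∀ j, 0 < (F *ᵥ βhat k m ω) j) ∧
          IGLSWellDefined (obsRows A O) F γ (Ybar m ω) k) ∧
      (∀ k, 1 ≤ k → ∀ᵐ ω ∂P, Tendsto (fun m => βhat k m ω) atTop (𝓝 β)) ∧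
      (∀ k, 2 ≤ k → IsLittleOP P (fun m ω => βhat k m ω - βGLS m ω)
        (fun m => √(sigmaSq σ ρ m)))) ∧
    GLSWellDefined (obsRows A O) F γ β ∧
    (CrossUncorrelated P Z → ∀ m, 1 ≤ m →
      (∀ a, MemLp (fun ω => βGLS m ω a) 2 P) ∧
      ∀ a b, cov[fun ω => βGLS m ω a, fun ω => βGLS m ω b; P] =
        sigmaSq σ ρ m * SigmaGLS (obsRows A O) F γ β a b) := by
  subst hYbar hβhat hβGLS
  set Ao := obsRows A O with hAo
  have hrow' : Ao.rank = Fintype.card O := by rw [hrow, Fintype.card_coe]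
  have hwd : GLSWellDefined Ao F γ β := glsWellDefined_of_pos hrow' hcol hpos
  set M : Matrix O J ℝ := σ • (Ao * diagonal fun j => |(F *ᵥ β) j| ^ γ) with hM
  have hY (m : ℕ) (hm : m ≠ 0) (ω : Ω) : obsMean O (linkTraffic A F β σ γ Z) t₀ m ω =
      (Ao * F) *ᵥ β + M *ᵥ noiseMean Z t₀ m ω :=
    obsMean_linkTraffic A O F β σ γ Z t₀ hm ω
  have hcont : Tendsto (fun z => (Ao * F) *ᵥ β + M *ᵥ z) (𝓝 0) (𝓝 ((Ao * F) *ᵥ β)) := by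
    have : Continuous fun z => (Ao * F) *ᵥ β + M *ᵥ z :=
      continuous_const.add (continuous_const.matrix_mulVec continuous_id)
    simpa using this.tendsto 0
  refine ⟨fun hρ => ?_, hwd, fun hcross m hm => ?_⟩
  · have hYlim : ∀ᵐ ω ∂P, Tendsto (fun m => obsMean O (linkTraffic A F β σ γ Z) t₀ m ω) atTop
        (𝓝 ((Ao * F) *ᵥ β)) := by
      filter_upwards [hZ.ae_tendsto_noiseMean hρ t₀] with ω hω
      refine (hcont.comp hω).congr' ?_
      filter_upwards [eventually_ne_atTop 0] with m hm
      exact (hY m hm ω).symm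
    refine ⟨fun k hk => ?_, fun k hk => ?_, fun k hk => ?_⟩
    · obtain ⟨k, rfl⟩ := Nat.exists_eq_add_of_le' hk
      filter_upwards [hYlim] with ω hω
      exact hω.eventually ((eventually_pos_iGLS hrow' hcol hγ hpos k).and
        (eventually_iGLSWellDefined hrow' hcol hγ hpos k))
    · obtain ⟨k, rfl⟩ := Nat.exists_eq_add_of_le' hk
      filter_upwards [hYlim] with ω hω
      exact (tendsto_iGLS hrow' hcol hγ hpos k).comp hω
    · obtain ⟨k, rfl⟩ := Nat.exists_eq_add_of_le' hk
      have hO : (fun z => M *ᵥ z) =O[𝓝 0] fun z => z :=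
        (LinearMap.toContinuousLinearMap M.mulVecLin).isBigO_id (𝓝 0)
      -- Composing with the affine map from noise to observation turns the observation error into M
      -- z, which is O(z).
      have hg := ((isLittleO_iGLS_sub_glsEstimate hrow' hcol hγ hpos k).comp_tendsto hcont)
      simp only [Function.comp_def, add_sub_cancel_left] at hg
      refine hZ.isLittleOP_of_isLittleO hρ t₀ hσ (hg.trans_isBigO hO) ?_
      -- At m = 0 the empty average is 0, so the decomposition into mean plus noise is only
      -- available for m ≠ 0.
      filter_upwards [eventually_ne_atTop 0] with m hm ω
      rw [← hY m hm ω]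
  -- By unbiasedness the estimate is exactly β plus a fixed linear image of the noise average, so
  -- its covariance is a matrix product.
  · have hest (ω : Ω) : glsEstimate Ao F γ β (obsMean O (linkTraffic A F β σ γ Z) t₀ m ω) =
        β + (glsMatrix Ao F γ β * M) *ᵥ noiseMean Z t₀ m ω := by
      rw [hY m (Nat.one_le_iff_ne_zero.1 hm) ω, glsEstimate_eq, mulVec_add, ← glsEstimate_eq,
        glsEstimate_mulVec hwd, mulVec_mulVec]
    simp only [hest]
    refine ⟨memLp_add_mulVec (hZ.memLp_noiseMean t₀ m) β _, fun a b => ?_⟩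
    have hMM : glsMatrix Ao F γ β * M * (glsMatrix Ao F γ β * M)ᵀ =
        σ ^ 2 • SigmaGLS Ao F γ β := by
      rw [← glsMatrix_mul_linkCov_mul_transpose hwd,
        ← mul_diagonal_mul_transpose_eq_linkCov Ao F γ hpos, hM]
      simp only [transpose_mul, transpose_smul, Matrix.mul_smul, Matrix.smul_mul, smul_smul,
        Matrix.mul_assoc, sq]
    rw [covariance_add_mulVec (v := sigmaSq 1 ρ m) (hZ.memLp_noiseMean t₀ m) ?_, hMM, sigmaSq_eq σ,
      Matrix.smul_apply, smul_eq_mul]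
    · ring
    · intro i j
      split_ifs with h
      · subst h
        rw [covariance_self (hZ.memLp_noiseMean t₀ m i).aemeasurable, hZ.variance_noiseMean]
      · exact hZ.covariance_noiseMean_of_ne hcross t₀ m h
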